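/- For a compact metric space $(X,d)$ and a compact Hausdorff space $K$, let $C(K)$ be the algebra of continuous complex-valued functions on $K$ with the supremum norm, and let $\mathrm{Lip}(X,C(K))$ be the ring (under pointwise operations) of all functions $f:X\to C(K)$ with $$L(f)=\sup_{x\neq x'}\frac{\|f(x)-f(x')\|_\infty}{d(x,x')}<\infty,$$ equipped with the Lipschitz norm $\|f\|_{\mathrm{Lip}}=\sup_{x\in X}\|f(x)\|_\infty+L(f)$. Let $X$ and $Y$ be compact metric spaces such that $Y$ is connected (in particular non-empty), let $K$ and $K'$ be compact Hausdorff spaces, and let $T:\mathrm{Lip}(X,C(K))\to \mathrm{Lip}(Y,C(K'))$ be a unital ring homomorphism (additive, multiplicative, $T(1)=1$; not assumed to be $\mathbb{C}$-linear) that is continuous with respect to the Lipschitz norms on both sides. Then there are a continuous function $\tau:K'\to K$, a family $\{\psi_s\}_{s\in K'}$ of continuous functions $\psi_s:Y\to X$, and a clopen subset $\mathcal{C}$ of $K'$ such that $$T(f)(y)(s)=\begin{cases} f(\psi_s(y))(\tau(s)), & s\in\mathcal{C},\\[2pt] \overline{f(\psi_s(y))(\tau(s))}, & s\in K'\setminus\mathcal{C},\end{cases}$$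 for all $f\in\mathrm{Lip}(X,C(K))$, $y\in Y$ and $s\in K'$. -/

import Mathlib

open scoped NNReal

noncomputable section

/-- The ring of all Lipschitz functions `X → E`, as a subring of the ring of all functions. -/
def lipSubring (X E : Type*) [MetricSpace X] [CompactSpace X] [NormedCommRing E] :
    Subring (X → E) where
  carrier := {f | ∃ C : ℝ≥0, LipschitzWith C f}
  zero_mem' := ⟨0, LipschitzWith.const 0⟩
  one_mem' := ⟨0, LipschitzWith.const 1⟩
  add_mem' := by
    rintro f g ⟨C, hf⟩ ⟨D, hg⟩
    exact ⟨C + D, hf.add hg⟩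
  neg_mem' := by
    rintro f ⟨C, hf⟩
    exact ⟨C, hf.neg⟩
  mul_mem' := by
    rintro f g ⟨C, hf⟩ ⟨D, hg⟩
    obtain ⟨M, hM⟩ := isCompact_univ.exists_bound_of_continuousOn hf.continuous.continuousOn
    obtain ⟨N, hN⟩ := isCompact_univ.exists_bound_of_continuousOn hg.continuous.continuousOn
    refine ⟨M.toNNReal * D + C * N.toNNReal, LipschitzWith.of_dist_le_mul fun x y => ?_⟩
    have e : (f * g) x - (f * g) y = f x * (g x - g y) + (f x - f y) * g y := by
      simp only [Pi.mul_apply]; ring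
    rw [dist_eq_norm, e]
    have h1 := hf.dist_le_mul x y
    have h2 := hg.dist_le_mul x y
    rw [dist_eq_norm] at h1 h2
    have h3 : ‖f x‖ ≤ M.toNNReal := (hM x (Set.mem_univ x)).trans (Real.le_coe_toNNReal M)
    have h4 : ‖g y‖ ≤ N.toNNReal := (hN y (Set.mem_univ y)).trans (Real.le_coe_toNNReal N)
    calc ‖f x * (g x - g y) + (f x - f y) * g y‖
        ≤ ‖f x‖ * ‖g x - g y‖ + ‖f x - f y‖ * ‖g y‖ :=
          (norm_add_le _ _).trans (add_le_add (norm_mul_le _ _) (norm_mul_le _ _))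
      _ ≤ M.toNNReal * (D * dist x y) + C * dist x y * N.toNNReal := by gcongr
      _ = ((M.toNNReal * D + C * N.toNNReal : ℝ≥0) : ℝ) * dist x y := by push_cast; ring

/-- `Lip(X, E)`: the ring of Lipschitz functions from the compact metric space `X` to `E`, with
pointwise operations.  (A separate type, so that its only topology is that of the Lipschitz norm
below.) -/
def Lip (X E : Type*) [MetricSpace X] [CompactSpace X] [NormedCommRing E] : Type _ :=
  lipSubring X E

namespace Lip

variable {X E : Type*} [MetricSpace X] [CompactSpace X] [NormedCommRing E]

instance instCommRing : CommRing (Lip X E) := inferInstanceAs (CommRing (lipSubring X E))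

instance instFunLike : FunLike (Lip X E) X E where
  coe f := f.1
  coe_injective _ _ h := Subtype.ext h

theorem add_apply (f g : Lip X E) (x : X) : (f + g) x = f x + g x := rfl
theorem mul_apply (f g : Lip X E) (x : X) : (f * g) x = f x * g x := rfl
theorem neg_apply (f : Lip X E) (x : X) : (-f) x = -f x := rfl
theorem zero_apply (x : X) : (0 : Lip X E) x = 0 := rfl
theorem one_apply (x : X) : (1 : Lip X E) x = 1 := rfl

theorem exists_lipschitzWith (f : Lip X E) : ∃ C : ℝ≥0, LipschitzWith C f := f.2

/-- The supremum norm `sup_x ‖f x‖`. -/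
def supNorm (f : Lip X E) : ℝ := ⨆ x : X, ‖f x‖

/-- The Lipschitz constant `L(f) = sup_{x ≠ y} ‖f x - f y‖ / d(x, y)`. -/
def lipConst (f : Lip X E) : ℝ :=
  ⨆ p : {p : X × X // p.1 ≠ p.2}, ‖f p.1.1 - f p.1.2‖ / dist p.1.1 p.1.2

theorem norm_le_supNorm (f : Lip X E) (x : X) : ‖f x‖ ≤ supNorm f := by
  obtain ⟨C, hC⟩ := f.exists_lipschitzWith
  obtain ⟨M, hM⟩ := isCompact_univ.exists_bound_of_continuousOn hC.continuous.continuousOn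
  refine le_ciSup (f := fun x : X => ‖f x‖) ⟨M, ?_⟩ x
  rintro _ ⟨y, rfl⟩
  exact hM y (Set.mem_univ y)

theorem supNorm_nonneg (f : Lip X E) : 0 ≤ supNorm f :=
  Real.iSup_nonneg fun _ => norm_nonneg _

theorem lipConst_nonneg (f : Lip X E) : 0 ≤ lipConst f :=
  Real.iSup_nonneg fun _ => div_nonneg (norm_nonneg _) dist_nonneg

theorem div_le_lipConst (f : Lip X E) (p : {p : X × X // p.1 ≠ p.2}) :
    ‖f p.1.1 - f p.1.2‖ / dist p.1.1 p.1.2 ≤ lipConst f := by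
  obtain ⟨C, hC⟩ := f.exists_lipschitzWith
  refine le_ciSup (f := fun p : {p : X × X // p.1 ≠ p.2} =>
    ‖f p.1.1 - f p.1.2‖ / dist p.1.1 p.1.2) ⟨C, ?_⟩ p
  rintro _ ⟨q, rfl⟩
  have h := hC.dist_le_mul q.1.1 q.1.2
  rw [dist_eq_norm] at h
  exact (div_le_iff₀ (dist_pos.2 q.2)).2 h

theorem norm_sub_le_lipConst (f : Lip X E) (x y : X) :
    ‖f x - f y‖ ≤ lipConst f * dist x y := by
  by_cases h : x = y
  · simp [h]
  · exact (div_le_iff₀ (dist_pos.2 h)).1 (div_le_lipConst f ⟨(x, y), h⟩)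

theorem supNorm_le {f : Lip X E} {M : ℝ} (hM : 0 ≤ M) (h : ∀ x, ‖f x‖ ≤ M) : supNorm f ≤ M :=
  Real.iSup_le h hM

theorem lipConst_le {f : Lip X E} {M : ℝ} (hM : 0 ≤ M)
    (h : ∀ x y, ‖f x - f y‖ ≤ M * dist x y) : lipConst f ≤ M :=
  Real.iSup_le (fun p => (div_le_iff₀ (dist_pos.2 p.2)).2 (h p.1.1 p.1.2)) hM

/-- The Lipschitz norm `‖f‖_Lip = ‖f‖_∞ + L(f)`, as a norm on the additive group `Lip(X, E)`. -/
def lipNorm (X E : Type*) [MetricSpace X] [CompactSpace X] [NormedCommRing E] :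
    AddGroupNorm (Lip X E) where
  toFun f := supNorm f + lipConst f
  map_zero' := by simp [supNorm, lipConst, zero_apply]
  neg' f := by
    have e : ∀ a b : E, ‖-a - -b‖ = ‖a - b‖ := fun a b => by
      rw [neg_sub_neg, norm_sub_rev]
    simp only [supNorm, lipConst, neg_apply, norm_neg, e]
  add_le' f g := by
    have h1 : supNorm (f + g) ≤ supNorm f + supNorm g :=
      supNorm_le (add_nonneg (supNorm_nonneg f) (supNorm_nonneg g)) fun x =>
        (norm_add_le _ _).trans (add_le_add (norm_le_supNorm f x) (norm_le_supNorm g x))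
    have h2 : lipConst (f + g) ≤ lipConst f + lipConst g := by
      refine lipConst_le (add_nonneg (lipConst_nonneg f) (lipConst_nonneg g)) fun x y => ?_
      rw [add_apply, add_apply, add_sub_add_comm, add_mul]
      exact (norm_add_le _ _).trans
        (add_le_add (norm_sub_le_lipConst f x y) (norm_sub_le_lipConst g x y))
    linarith
  eq_zero_of_map_eq_zero' f hf := by
    have h0 : supNorm f = 0 := by
      have h1 := supNorm_nonneg f
      have h2 := lipConst_nonneg f
      change supNorm f + lipConst f = 0 at hf
      linarith
    refine DFunLike.ext _ _ fun x => ?_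
    rw [zero_apply, ← norm_le_zero_iff, ← h0]
    exact norm_le_supNorm f x

theorem lipNorm_mul_le (f g : Lip X E) :
    lipNorm X E (f * g) ≤ lipNorm X E f * lipNorm X E g := by
  change supNorm (f * g) + lipConst (f * g) ≤
    (supNorm f + lipConst f) * (supNorm g + lipConst g)
  have a := supNorm_nonneg f
  have b := supNorm_nonneg g
  have c := lipConst_nonneg f
  have d := lipConst_nonneg g
  have h1 : supNorm (f * g) ≤ supNorm f * supNorm g :=
    supNorm_le (mul_nonneg a b) fun x => (norm_mul_le _ _).trans
      (mul_le_mul (norm_le_supNorm f x) (norm_le_supNorm g x) (norm_nonneg _) a)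
  have h2 : lipConst (f * g) ≤ supNorm f * lipConst g + lipConst f * supNorm g := by
    refine lipConst_le (by positivity) fun x y => ?_
    have e : (f * g) x - (f * g) y = f x * (g x - g y) + (f x - f y) * g y := by
      rw [mul_apply, mul_apply]; ring
    rw [e]
    calc ‖f x * (g x - g y) + (f x - f y) * g y‖
        ≤ ‖f x‖ * ‖g x - g y‖ + ‖f x - f y‖ * ‖g y‖ :=
          (norm_add_le _ _).trans (add_le_add (norm_mul_le _ _) (norm_mul_le _ _))
      _ ≤ supNorm f * (lipConst g * dist x y) + lipConst f * dist x y * supNorm g := by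
          gcongr
          · exact norm_le_supNorm f x
          · exact norm_sub_le_lipConst g x y
          · exact norm_sub_le_lipConst f x y
          · exact norm_le_supNorm g y
      _ = (supNorm f * lipConst g + lipConst f * supNorm g) * dist x y := by ring
  nlinarith [mul_nonneg c d]

/-- `Lip(X, E)` as a normed ring, with the Lipschitz norm `‖f‖_∞ + L(f)`. -/
instance instNormedCommRing : NormedCommRing (Lip X E) :=
  { (lipNorm X E).toNormedAddCommGroup, instCommRing with
    norm_mul_le := lipNorm_mul_le }

theorem norm_def (f : Lip X E) : ‖f‖ = supNorm f + lipConst f := rfl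

end Lip

end

/-! Fix a point `(y, s)`. Then `f ↦ T f y s` is a continuous ring homomorphism to `ℂ`, and on
scalars it is a continuous ring endomorphism of `ℂ`, hence the identity or conjugation. Its kernel
is a proper ideal, and proper ideals have a common zero `(x, k)` (`exists_common_zero`), so the
character is evaluation at `(x, k)`, possibly conjugated (`exists_eq_apply`). It remains to remove
the dependence on `y`. The function `T(i)` is continuous with values `±i`, so connectedness of `Y`
fixes the choice of automorphism for each `s`. The point `k` is locally constant in `y`: continuity
of `T` limits how fast `T f` varies when `f` is constant in `x` and small, while such `f` still
separate points of `K`. -/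

namespace Lip

/-! ### Test functions, evaluations and inverse-closedness -/

section Construction

variable {X : Type*} [MetricSpace X] [CompactSpace X]

/-- A Lipschitz function as an element of `Lip X E`. -/
def ofLipschitz {E : Type*} [NormedCommRing E] (f : X → E) (h : ∃ C : ℝ≥0, LipschitzWith C f) :
    Lip X E :=
  ⟨f, h⟩

theorem continuous_coe {E : Type*} [NormedCommRing E] (f : Lip X E) : Continuous f := by
  obtain ⟨C, hC⟩ := f.exists_lipschitzWith
  exact hC.continuous

/-- Constant functions, as a ring homomorphism. -/
def const (X : Type*) [MetricSpace X] [CompactSpace X] (E : Type*) [NormedCommRing E] :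
    E →+* Lip X E where
  toFun a := ofLipschitz (fun _ => a) ⟨0, LipschitzWith.const a⟩
  map_one' := rfl
  map_mul' _ _ := rfl
  map_zero' := rfl
  map_add' _ _ := rfl

theorem const_apply {E : Type*} [NormedCommRing E] (a : E) (x : X) : const X E a x = a :=
  rfl

theorem norm_const_le {E : Type*} [NormedCommRing E] (a : E) : ‖const X E a‖ ≤ ‖a‖ := by
  have h1 : supNorm (const X E a) ≤ ‖a‖ := supNorm_le (norm_nonneg a) fun _ => le_rfl
  have h2 : lipConst (const X E a) ≤ 0 := lipConst_le le_rfl fun _ _ => by simp [const_apply]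
  rw [norm_def]
  linarith

theorem continuous_const {E : Type*} [NormedCommRing E] : Continuous (const X E) :=
  AddMonoidHomClass.continuous_of_bound (const X E) 1 fun a => by
    simpa using norm_const_le (X := X) a

theorem norm_apply_le {E : Type*} [NormedCommRing E] (f : Lip X E) (x : X) : ‖f x‖ ≤ ‖f‖ := by
  rw [norm_def]
  linarith [norm_le_supNorm f x, lipConst_nonneg f]

theorem norm_sub_le {E : Type*} [NormedCommRing E] (f : Lip X E) (x y : X) :
    ‖f x - f y‖ ≤ ‖f‖ * dist x y := by
  refine (norm_sub_le_lipConst f x y).trans (mul_le_mul_of_nonneg_right ?_ dist_nonneg)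
  rw [norm_def]
  linarith [supNorm_nonneg f]

variable {K : Type*} [TopologicalSpace K] [CompactSpace K]

/-- Pointwise complex conjugation. -/
noncomputable def conj (f : Lip X C(K, ℂ)) : Lip X C(K, ℂ) :=
  ofLipschitz (fun x => star (f x)) <| by
    obtain ⟨C, hC⟩ := f.exists_lipschitzWith
    refine ⟨C, LipschitzWith.of_dist_le_mul fun x y => ?_⟩
    rw [dist_eq_norm, ← star_sub, norm_star, ← dist_eq_norm]
    exact hC.dist_le_mul x y

/-- The distance to a point, as an element of `Lip X C(K, ℂ)`. -/
noncomputable def distTo (K : Type*) [TopologicalSpace K] [CompactSpace K] (a : X) : Lip X C(K, ℂ) :=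
  ofLipschitz (fun x => ContinuousMap.const K (dist x a : ℂ)) <| by
    refine ⟨1, LipschitzWith.of_dist_le_mul fun x y => ?_⟩
    rw [NNReal.coe_one, one_mul, ContinuousMap.dist_le dist_nonneg]
    intro k
    simp only [ContinuousMap.const_apply, Complex.dist_eq, ← Complex.ofReal_sub,
      Complex.norm_real, Real.norm_eq_abs]
    exact abs_dist_sub_le x y a

/-- Scalars, as constant functions. -/
noncomputable def scalar (X K : Type*) [MetricSpace X] [CompactSpace X] [TopologicalSpace K] [CompactSpace K] :
    ℂ →+* Lip X C(K, ℂ) :=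
  (const X C(K, ℂ)).comp (algebraMap ℂ C(K, ℂ))

theorem scalar_apply (c : ℂ) (x : X) (k : K) : scalar X K c x k = c := by
  simp [scalar, const_apply]

theorem continuous_scalar : Continuous (scalar X K) :=
  continuous_const.comp (continuous_algebraMap ℂ C(K, ℂ))

/-- Evaluation at a pair of points. -/
noncomputable def eval (x : X) (k : K) : Lip X C(K, ℂ) →+* ℂ where
  toFun f := f x k
  map_one' := rfl
  map_mul' _ _ := rfl
  map_zero' := rfl
  map_add' _ _ := rfl

theorem continuous_eval (x : X) (k : K) : Continuous (eval x k) :=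
  AddMonoidHomClass.continuous_of_bound (eval x k) 1 fun f => by
    rw [one_mul]
    exact ((f x).norm_coe_le_norm k).trans (f.norm_apply_le x)

/-- A real continuous function, with complex values. -/
def ofRealMap {K : Type*} [TopologicalSpace K] (u : C(K, ℝ)) : C(K, ℂ) :=
  ⟨fun k => (u k : ℂ), by fun_prop⟩

theorem ofRealMap_apply {K : Type*} [TopologicalSpace K] (u : C(K, ℝ)) (k : K) : ofRealMap u k = (u k : ℂ) :=
  rfl

theorem continuous_uncurry [T2Space K] (f : Lip X C(K, ℂ)) :
    Continuous fun p : X × K => f p.1 p.2 := by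
  have := f.continuous_coe
  fun_prop

/-- `Lip X C(K, ℂ)` is inverse closed in the continuous functions on `X × K`. -/
theorem isUnit_of_forall_ne_zero [T2Space K] (f : Lip X C(K, ℂ)) (h : ∀ x k, f x k ≠ 0) :
    IsUnit f := by
  have hc : Continuous fun p : X × K => (f p.1 p.2)⁻¹ :=
    f.continuous_uncurry.inv₀ fun p => h p.1 p.2
  -- Compactness of `X × K` bounds the reciprocal by `M`; an inverse of a `C`-Lipschitz function is
  -- then `M * C * M`-Lipschitz.
  obtain ⟨M, hM⟩ := isCompact_univ.exists_bound_of_continuousOn hc.continuousOn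
  have hN : ∀ x k, ‖(f x k)⁻¹‖ ≤ M.toNNReal := fun x k =>
    (hM (x, k) (Set.mem_univ _)).trans (Real.le_coe_toNNReal M)
  obtain ⟨C, hC⟩ := f.exists_lipschitzWith
  let g : Lip X C(K, ℂ) := ofLipschitz
    (fun x => ⟨fun k => (f x k)⁻¹, hc.comp (Continuous.prodMk_right x)⟩) <| by
      refine ⟨M.toNNReal * C * M.toNNReal, LipschitzWith.of_dist_le_mul fun x y => ?_⟩
      rw [ContinuousMap.dist_le (by positivity)]
      intro k
      have e : (f x k)⁻¹ - (f y k)⁻¹ = (f x k)⁻¹ * (f y k - f x k) * (f y k)⁻¹ := by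
        have := h x k
        have := h y k
        field_simp
      have h1 : ‖f y k - f x k‖ ≤ C * dist x y := by
        rw [← dist_eq_norm, dist_comm]
        exact (ContinuousMap.dist_apply_le_dist k).trans (hC.dist_le_mul x y)
      change dist (f x k)⁻¹ (f y k)⁻¹ ≤ _
      rw [dist_eq_norm, e, norm_mul, norm_mul]
      calc _ ≤ (M.toNNReal : ℝ) * (C * dist x y) * M.toNNReal := by
            gcongr
            · exact hN x k
            · exact hN y k
        _ = _ := by push_cast; ring
  refine IsUnit.of_mul_eq_one g (DFunLike.ext _ _ fun x => ContinuousMap.ext fun k => ?_)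
  exact mul_inv_cancel₀ (h x k)

end Construction

/-! ### Ideals and characters -/

section Characters

variable {X K : Type*} [MetricSpace X] [CompactSpace X] [TopologicalSpace K] [CompactSpace K]
  [T2Space K]

/-- The elements of a proper ideal of `Lip X C(K, ℂ)` have a common zero. -/
theorem exists_common_zero (I : Ideal (Lip X C(K, ℂ))) (hI : I ≠ ⊤) :
    ∃ x k, ∀ f ∈ I, f x k = 0 := by
  by_contra! hne
  choose F hF hF0 using hne
  obtain ⟨t, ht⟩ := isCompact_univ.elim_finite_subcover
    (fun p : X × K => {q : X × K | F p.1 p.2 q.1 q.2 ≠ 0})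
    (fun p => isOpen_ne_fun (F p.1 p.2).continuous_uncurry _root_.continuous_const)
    (fun p _ => Set.mem_iUnion.2 ⟨p, hF0 p.1 p.2⟩)
  let ev (x : X) (k : K) : Lip X C(K, ℂ) →+ ℂ :=
    { toFun f := f x k, map_zero' := rfl, map_add' _ _ := rfl }
  -- The sum of the `|F|²` over the finite subcover lies in `I` and is positive everywhere, hence is
  -- a unit.
  refine hI (I.eq_top_of_isUnit_mem
    (sum_mem fun p (_ : p ∈ t) => I.mul_mem_right (conj (F p.1 p.2)) (hF p.1 p.2))
    (isUnit_of_forall_ne_zero _ fun x k => ?_))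
  have e : (∑ p ∈ t, F p.1 p.2 * conj (F p.1 p.2)) x k
      = ((∑ p ∈ t, Complex.normSq (F p.1 p.2 x k) : ℝ) : ℂ) := by
    rw [Complex.ofReal_sum]
    exact (map_sum (ev x k) _ t).trans
      (Finset.sum_congr rfl fun p _ => Complex.mul_conj (F p.1 p.2 x k))
  obtain ⟨p, hp, hne⟩ := Set.mem_iUnion₂.1 (ht (Set.mem_univ (x, k)))
  have hpos : 0 < ∑ p ∈ t, Complex.normSq (F p.1 p.2 x k) :=
    Finset.sum_pos' (fun _ _ => Complex.normSq_nonneg _) ⟨p, hp, Complex.normSq_pos.2 hne⟩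
  rw [e]
  exact Complex.ofReal_ne_zero.2 hpos.ne'

/-- A ring homomorphism to `ℂ` that fixes or conjugates the scalars is, up to that automorphism,
an evaluation. -/
theorem exists_eq_apply (φ : Lip X C(K, ℂ) →+* ℂ) (σ : ℂ →+* ℂ) (hσ : ∀ z, σ (σ z) = z)
    (h : ∀ c, φ (scalar X K c) = σ c) : ∃ x k, ∀ f, φ f = σ (f x k) := by
  obtain ⟨x, k, hz⟩ := exists_common_zero (RingHom.ker φ) (RingHom.ker_ne_top φ)
  refine ⟨x, k, fun f => ?_⟩
  -- `φ` sends the scalar `σ (φ f)` to `σ (σ (φ f)) = φ f`, so this difference lies in the kernel.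
  have h0 : (f - scalar X K (σ (φ f))) x k = 0 :=
    hz _ (by rw [RingHom.mem_ker, map_sub, h, hσ, sub_self])
  have h1 : f x k = σ (φ f) := by
    have h2 : f x k - scalar X K (σ (φ f)) x k = 0 := h0
    rwa [scalar_apply, sub_eq_zero] at h2
  rw [h1, hσ]

end Characters

section Separation

variable {K : Type*} [TopologicalSpace K] [CompactSpace K] [T2Space K]

/-- Urysohn's lemma with complex-valued functions. -/
theorem exists_urysohn {k : K} {U : Set K} (hU : U ∈ nhds k) :
    ∃ u : C(K, ℝ), u k = 0 ∧ (∀ k' ∉ U, u k' = 1) ∧ ∀ k', |u k'| ≤ 1 := by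
  obtain ⟨u, h0, h1, h01⟩ := exists_continuous_zero_one_of_isClosed
    (isClosed_singleton (x := k)) (isOpen_interior (s := U)).isClosed_compl
    (Set.disjoint_singleton_left.2 fun h => h (mem_interior_iff_mem_nhds.2 hU))
  refine ⟨u, h0 rfl, fun k' hk' => h1 fun h => hk' (interior_subset h), fun k' => ?_⟩
  rw [abs_le]
  exact ⟨by linarith [(h01 k').1], (h01 k').2⟩

end Separation

end Lip

/-! ### The representation theorem -/

open Lip in
theorem mainTheorem5
    {X Y K K' : Type*}
    [MetricSpace X] [CompactSpace X]
    [MetricSpace Y] [CompactSpace Y] [ConnectedSpace Y]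
    [TopologicalSpace K] [CompactSpace K] [T2Space K]
    [TopologicalSpace K'] [CompactSpace K'] [T2Space K']
    (T : Lip X C(K, ℂ) →+* Lip Y C(K', ℂ)) (hT : Continuous T) :
    ∃ (τ : K' → K) (ψ : K' → Y → X) (𝒞 : Set K'),
      Continuous τ ∧ (∀ s, Continuous (ψ s)) ∧ IsClopen 𝒞 ∧
      ∀ (f : Lip X C(K, ℂ)) (y : Y) (s : K'),
        (s ∈ 𝒞 → T f y s = f (ψ s y) (τ s)) ∧
        (s ∉ 𝒞 → T f y s = starRingEnd ℂ (f (ψ s y) (τ s))) := by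
  have hval : ∀ y s, Continuous ((eval y s).comp T) := fun y s =>
    (continuous_eval y s).comp hT
  have hscal : ∀ y s, ((eval y s).comp T).comp (scalar X K) = RingHom.id ℂ ∨
      ((eval y s).comp T).comp (scalar X K) = starRingEnd ℂ := fun y s =>
    Complex.ringHom_eq_id_or_conj_of_continuous ((hval y s).comp continuous_scalar)
  set J := T (scalar X K Complex.I) with hJ
  have hJc := J.continuous_uncurry
  have hJv : ∀ y s, J y s = Complex.I ∨ J y s = -Complex.I := fun y s =>
    (hscal y s).imp (fun h => DFunLike.congr_fun h Complex.I)
      (fun h => (DFunLike.congr_fun h Complex.I).trans Complex.conj_I)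
  have hII : -Complex.I ≠ Complex.I := fun h => by
    have := congrArg Complex.im h
    norm_num at this
  have hclopen : IsClopen {p : Y × K' | J p.1 p.2 = Complex.I} := by
    refine ⟨isClosed_eq hJc _root_.continuous_const, ?_⟩
    have : {p : Y × K' | J p.1 p.2 = Complex.I} = {p | J p.1 p.2 ≠ -Complex.I} := by
      ext p
      rcases hJv p.1 p.2 with h | h
      · simp [h, hII.symm]
      · simp [h, hII]
    rw [this]
    exact isOpen_ne_fun hJc _root_.continuous_const
  obtain ⟨y₀⟩ : Nonempty Y := inferInstance
  let 𝒞 : Set K' := {s | J y₀ s = Complex.I}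
  have h𝒞 : IsClopen 𝒞 := hclopen.preimage (Continuous.prodMk_right y₀)
  have hJy : ∀ y s, J y s = Complex.I ↔ s ∈ 𝒞 := fun y s => by
    -- A nonempty clopen slice of the connected space `Y` is everything.
    have hu := (hclopen.preimage (Continuous.prodMk_left (X := Y) s)).eq_univ
    constructor
    · intro h
      have : y₀ ∈ (fun y => (y, s)) ⁻¹' {p : Y × K' | J p.1 p.2 = Complex.I} := by
        rw [hu ⟨y, h⟩]; trivial
      exact this
    · intro h
      have : y ∈ (fun y => (y, s)) ⁻¹' {p : Y × K' | J p.1 p.2 = Complex.I} := by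
        rw [hu ⟨y₀, h⟩]; trivial
      exact this
  have key : ∀ y s, ∃ x k, ∀ f : Lip X C(K, ℂ), (s ∈ 𝒞 → T f y s = f x k) ∧
      (s ∉ 𝒞 → T f y s = starRingEnd ℂ (f x k)) := fun y s => by
    rcases hscal y s with h | h
    · obtain ⟨x, k, hf⟩ := exists_eq_apply ((eval y s).comp T) (RingHom.id ℂ) (fun _ => rfl) (DFunLike.congr_fun h)
      refine ⟨x, k, fun f => ⟨fun _ => hf f, fun hs => absurd ?_ hs⟩⟩
      exact (hJy y s).1 (DFunLike.congr_fun h Complex.I)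
    · obtain ⟨x, k, hf⟩ := exists_eq_apply ((eval y s).comp T) (starRingEnd ℂ) Complex.conj_conj
        (DFunLike.congr_fun h)
      refine ⟨x, k, fun f => ⟨fun hs => absurd ((hJy y s).2 hs) ?_, fun _ => hf f⟩⟩
      rw [show J y s = -Complex.I from (DFunLike.congr_fun h Complex.I).trans Complex.conj_I]
      exact hII
  choose ψ κ hψ using key
  -- Conjugation is invisible on real values, so real test functions treat both cases at once.
  have hreal : ∀ (f : Lip X C(K, ℂ)) y s (r : ℝ), f (ψ y s) (κ y s) = r → T f y s = r := by
    intro f y s r hr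
    by_cases hs : s ∈ 𝒞
    · rw [(hψ y s f).1 hs, hr]
    · rw [(hψ y s f).2 hs, hr, Complex.conj_ofReal]
  have hloc : ∃ δ > 0, ∀ y y' s, dist y y' < δ → κ y s = κ y' s := by
    obtain ⟨δ, hδ, hTδ⟩ := Metric.continuous_iff.1 hT 0 1 one_pos
    refine ⟨δ / 2, half_pos hδ, fun y y' s hyy => ?_⟩
    by_contra hne
    obtain ⟨u, hu0, hu1, hub⟩ := exists_urysohn (isOpen_ne.mem_nhds hne)
    have hu1' : u (κ y' s) = 1 := hu1 _ fun h => h rfl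
    -- Height `δ / 2` makes `‖f‖ < δ`, so `T f` has Lipschitz constant at most `1`; yet it would
    -- change by `δ / 2` between points closer than `δ / 2`.
    let f : Lip X C(K, ℂ) := const X C(K, ℂ) (ofRealMap ((δ / 2) • u))
    have hf : ‖f‖ < δ := by
      refine (norm_const_le _).trans_lt (lt_of_le_of_lt ?_ (half_lt_self hδ))
      rw [ContinuousMap.norm_le _ (half_pos hδ).le]
      intro k
      rw [ofRealMap_apply, Complex.norm_real, ContinuousMap.smul_apply, smul_eq_mul, norm_mul,
        Real.norm_of_nonneg (half_pos hδ).le]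
      exact mul_le_of_le_one_right (half_pos hδ).le (hub k)
    have hTf : ‖T f‖ < 1 := by
      have := hTδ f (by rwa [dist_zero_right])
      rwa [map_zero, dist_zero_right] at this
    have e0 : T f y s = (0 : ℝ) := hreal f y s 0 <| by
      simp [f, const_apply, ofRealMap_apply, hu0]
    have e1 : T f y' s = (δ / 2 : ℝ) := hreal f y' s (δ / 2) <| by
      simp [f, const_apply, ofRealMap_apply, hu1']
    have h1 : ‖T f y s - T f y' s‖ ≤ ‖T f‖ * dist y y' :=
      ((T f y - T f y').norm_coe_le_norm s).trans (norm_sub_le _ _ _)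
    rw [e0, e1, ← Complex.ofReal_sub, Complex.norm_real, zero_sub, norm_neg,
      Real.norm_of_nonneg (half_pos hδ).le] at h1
    exact absurd (h1.trans (mul_le_of_le_one_left dist_nonneg hTf.le)) (not_le.2 hyy)
  obtain ⟨δ, hδ, hloc⟩ := hloc
  have hκ : ∀ y s, κ y s = κ y₀ s := fun y s => by
    have : IsLocallyConstant fun y => κ y s :=
      (IsLocallyConstant.iff_eventually_eq _).2 fun y =>
        Filter.mem_of_superset (Metric.ball_mem_nhds y hδ) fun y' hy' => hloc y' y s hy'
    exact this.apply_eq_of_isPreconnected isPreconnected_univ trivial trivial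
  refine ⟨κ y₀, fun s y => ψ y s, 𝒞, ?_, fun s => ?_, h𝒞, fun f y s => ?_⟩
  · refine continuous_iff_continuousAt.2 fun s => ?_
    intro U hU
    obtain ⟨u, hu0, hu1, -⟩ := exists_urysohn hU
    let f : Lip X C(K, ℂ) := const X C(K, ℂ) (ofRealMap u)
    have e : ∀ s, T f y₀ s = u (κ y₀ s) := fun s => hreal f y₀ s _ rfl
    -- This open set contains `s` and is mapped into `U`, as `u = 1` off `U`.
    have hopen : IsOpen {s' | T f y₀ s' ≠ 1} :=
      isOpen_ne_fun (T f y₀).continuous _root_.continuous_const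
    refine Filter.mem_map.2 (Filter.mem_of_superset (hopen.mem_nhds (x := s) ?_) fun s' hs' => ?_)
    · simp [e, hu0]
    · by_contra hn
      exact hs' (by rw [e, hu1 _ hn, Complex.ofReal_one])
  · refine continuous_iff_continuousAt.2 fun y => tendsto_iff_dist_tendsto_zero.2 ?_
    -- The image of the distance function to `ψ y s` measures how far `ψ` moves, and it is
    -- continuous in `y'`.
    have e : ∀ y', T (distTo K (ψ y s)) y' s = (dist (ψ y' s) (ψ y s) : ℝ) := fun y' =>
      hreal _ y' s _ rfl
    have hc : Continuous fun y' => dist (ψ y' s) (ψ y s) := by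
      have := Complex.continuous_re.comp
        ((T (distTo K (ψ y s))).continuous_uncurry.comp (Continuous.prodMk_left s))
      exact this.congr fun y' => by simp [e]
    simpa using hc.tendsto y
  · rw [← hκ y s]
    exact hψ y s f
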